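/- Let $\sigma,\tau$ be real numbers with $\tau<0$ and $\tau-\sigma>1/2$, and let $E$ be the infinite matrix $$ E=\left\{\frac{n^\sigma m^\sigma}{[n,m]^\tau}\right\}_{n,m=1}^\infty , $$ where $[n,m]$ denotes the least common multiple of $n$ and $m$. (Equivalently, with $t=-\tau$ and $\rho=\tau-2\sigma$, the entries of $E$ are $[n,m]^t/(nm)^{(\rho+t)/2}$ and the assumption is $t>0$, $\rho>t+1$.) Then $E$ defines a bounded, compact and self-adjoint operator on $\ell^2(\mathbb N)$, $\mathbb N=\{1,2,3,\dots\}$, and this operator has trivial kernel. It has infinitely many negative eigenvalues and infinitely many positive eigenvalues. -/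

import Mathlib

/-- The infinite arithmetical matrix whose `(n, m)` entry is `n ^ σ * m ^ σ / [n, m] ^ τ`,
where `n, m ≥ 1` and `[n, m]` is the least common multiple of `n` and `m`. -/
noncomputable def arithMatrix (σ τ : ℝ) : Matrix ℕ+ ℕ+ ℝ :=
  Matrix.of fun n m => (n : ℝ) ^ σ * (m : ℝ) ^ σ / ((Nat.lcm n m : ℕ) : ℝ) ^ τ

/-- The bounded operator `T` on the Hilbert space `ℓ²({1, 2, 3, …}; 𝕜)` is the one given by the
infinite real matrix `A`: for each `x` and `n` the series `∑ m, A n m * x m` converges to the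
`n`-th coordinate of `T x`. (There is at most one such `T` for a given `A`.) -/
def IsOperatorOfMatrix {𝕜 : Type*} [RCLike 𝕜] (A : Matrix ℕ+ ℕ+ ℝ)
    (T : lp (fun _ : ℕ+ => 𝕜) 2 →L[𝕜] lp (fun _ : ℕ+ => 𝕜) 2) : Prop :=
  ∀ (x : lp (fun _ : ℕ+ => 𝕜) 2) (n : ℕ+),
    HasSum (fun m : ℕ+ => ((A n m : ℝ) : 𝕜) * x m) (T x n)

/-! Put s = τ - σ and t = -τ. The entries are n^(-s) m^(-s) gcd(n,m)^(-t), and gcd(n,m)^(-t) is the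
sum of J(d) over the common divisors d, where J = `negJordan t`. So E = ∑ J(d) w_d ⊗ w_d with w_d =
`multiplesVec`. Since |J| ≤ 1 and ‖w_d‖² is a constant times d^(-2s) with 2s > 1, the series
converges in norm, which gives compactness and self-adjointness. Möbius inversion yields vectors v_q
= `divisorsVec` biorthogonal to the w_d. They diagonalise the form: ⟨v_q, E v_r⟩ is J(q) if q = r
and 0 otherwise. As J(p) < 0 and J(pq) > 0 for distinct primes, the form is definite of either sign
on infinite-dimensional subspaces, and `infinite_negative_eigenvalues` applies to E and to -E. If Ex
= 0, pairing with v_q gives J(q)⟨w_q, x⟩ = 0 with J(q) ≠ 0, and a sieve then forces x = 0. -/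

/-! ### Counting negative eigenvalues through the quadratic form. -/

section Spectral

open Module.End

variable {𝕜 H : Type*} [RCLike 𝕜] [NormedAddCommGroup H] [InnerProductSpace 𝕜 H]

/-- A symmetric operator is nonnegative on the span of its eigenvectors with nonnegative
eigenvalues. -/
theorem LinearMap.IsSymmetric.re_inner_nonneg_of_mem_iSup_eigenspace {T : H →ₗ[𝕜] H}
    (hT : T.IsSymmetric) {ι : Type*} {μ : ι → ℝ} (hμ : Function.Injective μ)
    (hμ0 : ∀ i, 0 ≤ μ i) {x : H} (hx : x ∈ ⨆ i, eigenspace T (μ i : 𝕜)) :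
    0 ≤ RCLike.re (inner 𝕜 x (T x)) := by
  classical
  obtain ⟨f, hf, rfl⟩ := (Submodule.mem_iSup_iff_exists_finsupp _ _).1 hx
  have hTf (i : ι) : T (f i) = (μ i : 𝕜) • f i := mem_eigenspace_iff.1 (hf i)
  have horth {i j : ι} (hij : i ≠ j) : inner 𝕜 (f i) (f j) = 0 :=
    Submodule.isOrtho_iff_inner_eq.1 (hT.orthogonalFamily_eigenspaces.isOrtho
      (fun h => hij (hμ (RCLike.ofReal_injective h)))) _ (hf i) _ (hf j)
  have key : inner 𝕜 (f.sum fun _ y => y) (T (f.sum fun _ y => y)) =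
      ∑ i ∈ f.support, ((μ i * ‖f i‖ ^ 2 : ℝ) : 𝕜) := by
    simp only [Finsupp.sum, map_sum, sum_inner, inner_sum]
    refine Finset.sum_congr rfl fun i hi => ?_
    rw [Finset.sum_eq_single i]
    · rw [hTf, inner_smul_right, inner_self_eq_norm_sq_to_K]; push_cast; rfl
    · intro j _ hj
      rw [hTf, inner_smul_right, horth hj, mul_zero]
    · exact fun h => (h hi).elim
  rw [key, map_sum]
  refine Finset.sum_nonneg fun i _ => ?_
  rw [RCLike.ofReal_re]
  have := hμ0 i
  positivity

/-- If `T` is compact and self-adjoint, then its quadratic form is nonnegative on the orthogonal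
complement of the eigenvectors with negative eigenvalues. -/
theorem ContinuousLinearMap.re_inner_nonneg_of_mem_orthogonal_negative [CompleteSpace H]
    {T : H →L[𝕜] H} (hc : IsCompactOperator T) (hT : (T : H →ₗ[𝕜] H).IsSymmetric)
    {x : H} (hx : x ∈ (⨆ r : {r : ℝ // r < 0 ∧ HasEigenvalue (T : H →ₗ[𝕜] H) (r : 𝕜)},
      eigenspace (T : H →ₗ[𝕜] H) ((r : ℝ) : 𝕜))ᗮ) :
    0 ≤ RCLike.re (inner 𝕜 x (T x)) := by
  set N := ⨆ r : {r : ℝ // r < 0 ∧ HasEigenvalue (T : H →ₗ[𝕜] H) (r : 𝕜)},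
      eigenspace (T : H →ₗ[𝕜] H) ((r : ℝ) : 𝕜) with hN
  set P := ⨆ r : {r : ℝ // 0 ≤ r}, eigenspace (T : H →ₗ[𝕜] H) ((r : ℝ) : 𝕜) with hP
  -- Spectral theorem: all eigenvalues are real, so every eigenspace lies in `N` or in `P`.
  have hNP : Nᗮ ⊓ Pᗮ = ⊥ := by
    rw [Submodule.inf_orthogonal, eq_bot_iff,
      ← orthogonalComplement_iSup_eigenspaces_eq_bot hc hT]
    refine Submodule.orthogonal_le (iSup_le fun μ => ?_)
    by_cases hμ : HasEigenvalue (T : H →ₗ[𝕜] H) μ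
    · have hre : ((RCLike.re μ : ℝ) : 𝕜) = μ :=
        RCLike.conj_eq_iff_re.1 (hT.conj_eigenvalue_eq_self hμ)
      rcases lt_or_ge (RCLike.re μ) 0 with h | h
      · refine le_trans ?_ (le_sup_left : N ≤ N ⊔ P)
        refine le_trans (le_of_eq ?_) (le_iSup _ ⟨RCLike.re μ, h, by rwa [hre]⟩)
        simp only [hre]
      · refine le_trans ?_ (le_sup_right : P ≤ N ⊔ P)
        refine le_trans (le_of_eq ?_) (le_iSup _ ⟨RCLike.re μ, h⟩)
        simp only [hre]
    · rw [hasEigenvalue_iff, not_not] at hμ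
      exact (le_of_eq hμ).trans bot_le
  have hle : P ≤ Nᗮ := by
    rw [← Submodule.isOrtho_iff_le, hP, hN, Submodule.isOrtho_iSup_left]
    refine fun q => Submodule.isOrtho_iSup_right.2 fun r =>
      hT.orthogonalFamily_eigenspaces.isOrtho fun h => ?_
    have h' : (q : ℝ) = r := RCLike.ofReal_injective h
    exact absurd q.2 (not_le.2 (h'.symm ▸ r.2.1))
  have hxP : x ∈ P.topologicalClosure := by
    have hcl : P.topologicalClosure ≤ Nᗮ :=
      Submodule.topologicalClosure_minimal _ hle N.isClosed_orthogonal
    obtain ⟨p, hp, r, hr, rfl⟩ :=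
      P.topologicalClosure.exists_add_mem_mem_orthogonal x
    have hrN : r ∈ Nᗮ := (Submodule.add_mem_iff_right _ (hcl hp)).1 hx
    rw [Submodule.orthogonal_closure] at hr
    have : r ∈ Nᗮ ⊓ Pᗮ := ⟨hrN, hr⟩
    rw [hNP, Submodule.mem_bot] at this
    rw [this, add_zero]
    exact hp
  refine closure_minimal (t := {y | 0 ≤ RCLike.re (inner 𝕜 y (T y))}) (fun y hy => ?_)
    (isClosed_le continuous_const (by fun_prop)) hxP
  exact hT.re_inner_nonneg_of_mem_iSup_eigenspace Subtype.val_injective (fun i => i.2) hy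

/-- A compact self-adjoint operator whose quadratic form is negative definite on an
infinite-dimensional subspace has infinitely many negative eigenvalues. -/
theorem ContinuousLinearMap.infinite_negative_eigenvalues [CompleteSpace H]
    {T : H →L[𝕜] H} (hc : IsCompactOperator T) (hT : (T : H →ₗ[𝕜] H).IsSymmetric)
    {v : ℕ → H} {c : ℕ → ℝ} (hc0 : ∀ i, c i < 0)
    (hv : ∀ i j, inner 𝕜 (v i) (T (v j)) = if i = j then (c i : 𝕜) else 0) :
    {r : ℝ | r < 0 ∧ HasEigenvalue (T : H →ₗ[𝕜] H) (r : 𝕜)}.Infinite := by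
  intro hfin
  have : Finite {r : ℝ // r < 0 ∧ HasEigenvalue (T : H →ₗ[𝕜] H) (r : 𝕜)} := hfin.to_subtype
  let N := ⨆ r : {r : ℝ // r < 0 ∧ HasEigenvalue (T : H →ₗ[𝕜] H) (r : 𝕜)},
    eigenspace (T : H →ₗ[𝕜] H) ((r : ℝ) : 𝕜)
  have (r : {r : ℝ // r < 0 ∧ HasEigenvalue (T : H →ₗ[𝕜] H) (r : 𝕜)}) :
      FiniteDimensional 𝕜 (eigenspace (T : H →ₗ[𝕜] H) ((r : ℝ) : 𝕜)) :=
    finite_dimensional_eigenspace hc _ (by exact_mod_cast r.2.1.ne)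
  have : FiniteDimensional 𝕜 N := Submodule.finiteDimensional_iSup _
  let k := Module.finrank 𝕜 N
  let L : (Fin (k + 1) → 𝕜) →ₗ[𝕜] H := Fintype.linearCombination 𝕜 fun i => v i
  -- With k + 1 vectors against dim `N` = k, the projection onto `N` kills some nonzero coefficient
  -- vector.
  obtain ⟨a, ha, ha0⟩ := Submodule.exists_mem_ne_zero_of_ne_bot
    (LinearMap.ker_ne_bot_of_finrank_lt
      (f := (N.orthogonalProjectionOnto : H →ₗ[𝕜] N) ∘ₗ L) (by simp [k]))
  have hLa : L a ∈ Nᗮ := by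
    rw [← Submodule.ker_orthogonalProjectionOnto]
    simpa using ha
  have hnn := re_inner_nonneg_of_mem_orthogonal_negative hc hT hLa
  have hform : inner 𝕜 (L a) (T (L a)) = ((∑ i : Fin (k + 1), c i * ‖a i‖ ^ 2 : ℝ) : 𝕜) := by
    simp only [L, Fintype.linearCombination_apply, map_sum, map_smul, sum_inner, inner_sum,
      inner_smul_left, inner_smul_right, hv, Fin.val_inj]
    simp only [mul_ite, mul_zero, Finset.sum_ite_eq', Finset.mem_univ, if_true]
    push_cast
    refine Finset.sum_congr rfl fun i _ => ?_
    rw [← RCLike.conj_mul]; ring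
  rw [hform, RCLike.ofReal_re] at hnn
  refine absurd hnn (not_le.2 ?_)
  obtain ⟨i, hi⟩ := Function.ne_iff.1 ha0
  refine Finset.sum_neg' (fun j _ => ?_) ⟨i, Finset.mem_univ _, ?_⟩
  · exact mul_nonpos_of_nonpos_of_nonneg (hc0 _).le (by positivity)
  · exact mul_neg_of_neg_of_pos (hc0 _) (by have := norm_pos_iff.2 hi; positivity)

end Spectral

/-! ### The Jordan function of negative order and Möbius identities. -/

section Arithmetic

open scoped ArithmeticFunction.Moebius ArithmeticFunction.zeta

/-- The arithmetic function `n ↦ n ^ (-t)`, with value `0` at `0`. -/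
noncomputable def negRpowArith (t : ℝ) : ArithmeticFunction ℝ :=
  ⟨fun n => if n = 0 then 0 else (n : ℝ) ^ (-t), if_pos rfl⟩

theorem negRpowArith_apply (t : ℝ) {n : ℕ} (hn : n ≠ 0) :
    negRpowArith t n = (n : ℝ) ^ (-t) := if_neg hn

theorem negRpowArith_isMultiplicative (t : ℝ) : (negRpowArith t).IsMultiplicative := by
  refine ArithmeticFunction.IsMultiplicative.iff_ne_zero.2 ⟨?_, fun {m n} hm hn _ => ?_⟩
  · rw [negRpowArith_apply t one_ne_zero]; simp
  · rw [negRpowArith_apply t hm, negRpowArith_apply t hn,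
      negRpowArith_apply t (mul_ne_zero hm hn), Nat.cast_mul,
      Real.mul_rpow (Nat.cast_nonneg _) (Nat.cast_nonneg _)]

/-- The Jordan totient function of order `-t`: the Möbius transform of `n ↦ n ^ (-t)`. -/
noncomputable def negJordan (t : ℝ) : ArithmeticFunction ℝ :=
  (μ : ArithmeticFunction ℝ) * negRpowArith t

theorem negJordan_isMultiplicative (t : ℝ) : (negJordan t).IsMultiplicative :=
  ArithmeticFunction.isMultiplicative_moebius.intCast.mul (negRpowArith_isMultiplicative t)

theorem sum_divisors_negJordan (t : ℝ) {n : ℕ} (hn : n ≠ 0) :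
    ∑ d ∈ n.divisors, negJordan t d = (n : ℝ) ^ (-t) := by
  rw [← negRpowArith_apply t hn, ← ArithmeticFunction.coe_zeta_mul_apply, negJordan, ← mul_assoc,
    ArithmeticFunction.coe_zeta_mul_coe_moebius, one_mul]

/-- Difference of the divisor sums at p^(k+1) and p^k. Sign, size and nonvanishing of `negJordan`
all follow from this by multiplicativity. -/
theorem negJordan_prime_pow (t : ℝ) {p : ℕ} (hp : p.Prime) (k : ℕ) :
    negJordan t (p ^ (k + 1)) = ((p : ℝ) ^ (-t)) ^ k * ((p : ℝ) ^ (-t) - 1) := by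
  have h (j : ℕ) : ∑ i ∈ Finset.range (j + 1), negJordan t (p ^ i) = ((p : ℝ) ^ (-t)) ^ j := by
    rw [← Nat.sum_divisors_prime_pow hp, sum_divisors_negJordan t (pow_ne_zero _ hp.ne_zero),
      Nat.cast_pow, ← Real.rpow_natCast_mul (Nat.cast_nonneg _),
      ← Real.rpow_mul_natCast (Nat.cast_nonneg _), mul_comm]
  have h1 := h (k + 1)
  rw [Finset.sum_range_succ, h k] at h1
  linear_combination h1

theorem rpow_neg_prime_mem_Ioo {t : ℝ} (ht : 0 < t) {p : ℕ} (hp : p.Prime) :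
    (p : ℝ) ^ (-t) ∈ Set.Ioo (0 : ℝ) 1 :=
  ⟨Real.rpow_pos_of_pos (by exact_mod_cast hp.pos) _,
    Real.rpow_lt_one_of_one_lt_of_neg (by exact_mod_cast hp.one_lt) (neg_lt_zero.2 ht)⟩

theorem negJordan_prime_neg {t : ℝ} (ht : 0 < t) {p : ℕ} (hp : p.Prime) : negJordan t p < 0 := by
  have := negJordan_prime_pow t hp 0
  rw [zero_add, pow_one, pow_zero, one_mul] at this
  rw [this]
  linarith [(rpow_neg_prime_mem_Ioo ht hp).2]

theorem negJordan_prime_mul_prime_pos {t : ℝ} (ht : 0 < t) {p q : ℕ} (hp : p.Prime)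
    (hq : q.Prime) (hpq : p ≠ q) : 0 < negJordan t (p * q) := by
  rw [(negJordan_isMultiplicative t).map_mul_of_coprime ((Nat.coprime_primes hp hq).2 hpq)]
  exact mul_pos_of_neg_of_neg (negJordan_prime_neg ht hp) (negJordan_prime_neg ht hq)

theorem negJordan_ne_zero {t : ℝ} (ht : 0 < t) {n : ℕ} (hn : n ≠ 0) : negJordan t n ≠ 0 := by
  rw [(negJordan_isMultiplicative t).multiplicative_factorization _ hn]
  refine Finset.prod_ne_zero_iff.2 fun p hp => ?_
  have hpp := Nat.prime_of_mem_primeFactors hp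
  obtain ⟨k, hk⟩ := Nat.exists_eq_succ_of_ne_zero (Finsupp.mem_support_iff.1 hp)
  simp only [hk, Nat.succ_eq_add_one, negJordan_prime_pow t hpp]
  have h := rpow_neg_prime_mem_Ioo ht hpp
  exact mul_ne_zero (pow_ne_zero _ h.1.ne') (sub_ne_zero.2 h.2.ne)

theorem abs_negJordan_le_one {t : ℝ} (ht : 0 < t) (n : ℕ) : |negJordan t n| ≤ 1 := by
  rcases eq_or_ne n 0 with rfl | hn
  · simp
  rw [(negJordan_isMultiplicative t).multiplicative_factorization _ hn, Finsupp.prod,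
    Finset.abs_prod]
  refine Finset.prod_le_one (fun _ _ => abs_nonneg _) fun p hp => ?_
  have hpp := Nat.prime_of_mem_primeFactors hp
  obtain ⟨k, hk⟩ := Nat.exists_eq_succ_of_ne_zero (Finsupp.mem_support_iff.1 hp)
  rw [hk, negJordan_prime_pow t hpp, abs_mul]
  have h := rpow_neg_prime_mem_Ioo ht hpp
  refine mul_le_one₀ ?_ (abs_nonneg _) ?_
  · rw [abs_of_nonneg (pow_nonneg h.1.le _)]; exact pow_le_one₀ h.1.le h.2.le
  · rw [abs_le]; constructor <;> linarith [h.1, h.2]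

/-- Möbius inversion of the divisibility indicator. -/
theorem sum_moebius_mul_dvd_indicator (R : Type*) [Ring R] {q : ℕ} (hq : q ≠ 0) (d : ℕ) :
    ∑ x ∈ q.divisorsAntidiagonal, ((μ x.1 : ℤ) : R) * (if d ∣ x.2 then 1 else 0) =
      if q = d then 1 else 0 := by
  refine (ArithmeticFunction.sum_eq_iff_sum_mul_moebius_eq
    (f := fun i => if i = d then (1 : R) else 0)
    (g := fun n => if d ∣ n then (1 : R) else 0)).1 (fun n hn => ?_) q (Nat.pos_of_ne_zero hq)
  simp [Finset.sum_ite_eq', hn.ne']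

/-- The Möbius function detects coprimality. -/
theorem sum_divisors_moebius_dvd (R : Type*) [Ring R] {P : ℕ} (hP : P ≠ 0) (m : ℕ) :
    ∑ k ∈ P.divisors, (if k ∣ m then ((μ k : ℤ) : R) else 0) =
      if Nat.Coprime m P then 1 else 0 := by
  have h : P.divisors.filter (· ∣ m) = (Nat.gcd m P).divisors := by
    ext k
    simp only [Finset.mem_filter, Nat.mem_divisors, Nat.dvd_gcd_iff, ne_eq, Nat.gcd_eq_zero_iff]
    tauto
  rw [← Finset.sum_filter, h]
  have h2 := congrArg (fun f => f (Nat.gcd m P)) ArithmeticFunction.coe_zeta_mul_moebius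
  simp only [ArithmeticFunction.coe_zeta_mul_apply, ArithmeticFunction.one_apply] at h2
  rw [← Int.cast_sum, h2]
  by_cases hc : Nat.Coprime m P
  · rw [if_pos hc, if_pos hc, Int.cast_one]
  · rw [if_neg hc, if_neg hc, Int.cast_zero]

end Arithmetic

/-! ### The vectors w_d and their biorthogonal system. -/

section MultiplesVector

open scoped ArithmeticFunction.Moebius

open Filter Topology

theorem PNat.summable_rpow_neg_sq {s : ℝ} (hs : 1 / 2 < s) :
    Summable fun n : ℕ+ => ((n : ℝ) ^ (-s)) ^ 2 := by
  have h : Summable fun n : ℕ => (n : ℝ) ^ (-(2 * s)) :=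
    Real.summable_nat_rpow.2 (by linarith)
  refine (h.comp_injective PNat.coe_injective).congr fun n => ?_
  rw [Function.comp_apply, ← Real.rpow_mul_natCast (Nat.cast_nonneg _)]
  congr 1; push_cast; ring

theorem memℓp_rpow_neg_multiples (𝕜 : Type*) [RCLike 𝕜] {s : ℝ} (hs : 1 / 2 < s) (d : ℕ+) :
    Memℓp (fun n : ℕ+ => if (d : ℕ) ∣ n then (((n : ℝ) ^ (-s) : ℝ) : 𝕜) else 0) 2 := by
  refine memℓp_gen ((PNat.summable_rpow_neg_sq hs).of_nonneg_of_le (fun n => by positivity)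
    fun n => ?_)
  simp only [ENNReal.toReal_ofNat, Real.rpow_ofNat]
  split_ifs
  · simp
  · simp; positivity

/-- The vector `∑ n, n ^ (-s) e_n` of `ℓ²`, the sum being over the multiples `n` of `d`. -/
noncomputable def multiplesVec (𝕜 : Type*) [RCLike 𝕜] {s : ℝ} (hs : 1 / 2 < s) (d : ℕ+) :
    lp (fun _ : ℕ+ => 𝕜) 2 :=
  ⟨_, memℓp_rpow_neg_multiples 𝕜 hs d⟩

variable {𝕜 : Type*} [RCLike 𝕜] {s : ℝ} (hs : 1 / 2 < s)

theorem multiplesVec_apply (d n : ℕ+) : multiplesVec 𝕜 hs d n =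
    if (d : ℕ) ∣ n then (((n : ℝ) ^ (-s) : ℝ) : 𝕜) else 0 := rfl

/-- Substituting n = dm pulls out the factor d^(-2s), which is what makes the operator series
summable. -/
theorem norm_multiplesVec_sq (d : ℕ+) : ‖multiplesVec 𝕜 hs d‖ ^ 2 =
    ((d : ℝ) ^ (-s)) ^ 2 * ∑' n : ℕ+, ((n : ℝ) ^ (-s)) ^ 2 := by
  have h := lp.norm_rpow_eq_tsum (p := 2) (by simp) (multiplesVec 𝕜 hs d)
  simp only [ENNReal.toReal_ofNat, Real.rpow_ofNat] at h
  have hsupp : Function.support (fun n => ‖multiplesVec 𝕜 hs d n‖ ^ 2) ⊆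
      Set.range (fun m : ℕ+ => d * m) := by
    intro n hn
    by_cases hd : (d : ℕ) ∣ n
    · obtain ⟨m, rfl⟩ := PNat.dvd_iff.2 hd
      exact ⟨m, rfl⟩
    · simp [multiplesVec_apply, hd] at hn
  rw [h, ← (mul_right_injective d).tsum_eq hsupp, ← tsum_mul_left]
  refine tsum_congr fun m => ?_
  rw [multiplesVec_apply, if_pos (by simp), RCLike.norm_ofReal, sq_abs, PNat.mul_coe,
    Nat.cast_mul, Real.mul_rpow (by positivity) (by positivity), mul_pow]

theorem inner_multiplesVec (d : ℕ+) (x : lp (fun _ : ℕ+ => 𝕜) 2) :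
    HasSum (fun n : ℕ+ => if (d : ℕ) ∣ n then (((n : ℝ) ^ (-s) : ℝ) : 𝕜) * x n else 0)
      (inner 𝕜 (multiplesVec 𝕜 hs d) x) := by
  refine (lp.hasSum_inner (multiplesVec 𝕜 hs d) x).congr_fun fun n => ?_
  rw [multiplesVec_apply]
  split_ifs <;> simp [mul_comm]

/-- The vectors `multiplesVec` span a dense subspace of `ℓ²`. -/
theorem eq_zero_of_forall_inner_multiplesVec_eq_zero {x : lp (fun _ : ℕ+ => 𝕜) 2}
    (hx : ∀ d, inner 𝕜 (multiplesVec 𝕜 hs d) x = 0) : x = 0 := by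
  set a : ℕ+ → 𝕜 := fun n => (((n : ℝ) ^ (-s) : ℝ) : 𝕜) * x n with ha
  have hsum : Summable fun n => ‖a n‖ := by
    have := (inner_multiplesVec hs 1 x).summable.norm
    simpa [ha] using this
  ext d
  -- Inclusion-exclusion over the divisors k of N!, using ⟨w_(dk), x⟩ = 0. The sum over k is finite,
  -- so no double series has to be rearranged.
  have hsieve (N : ℕ) :
      ∑' n : ℕ+, (if (d : ℕ) ∣ n ∧ Nat.Coprime (n / d) N.factorial then a n else 0) = 0 := by
    have h1 : HasSum (fun n : ℕ+ => ∑ k ∈ N.factorial.divisors, ((μ k : ℤ) : 𝕜) *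
        if (d : ℕ) * k ∣ n then a n else 0) (∑ k ∈ N.factorial.divisors, (0 : 𝕜)) := by
      refine hasSum_sum fun k hk => ?_
      have hk0 : 0 < k := Nat.pos_of_mem_divisors hk
      have h2 := (inner_multiplesVec hs (d * ⟨k, hk0⟩) x).mul_left ((μ k : ℤ) : 𝕜)
      rw [hx, mul_zero] at h2
      exact h2
    rw [Finset.sum_const_zero] at h1
    refine (tsum_congr fun n => ?_).trans h1.tsum_eq
    by_cases hd : (d : ℕ) ∣ n
    · have h3 := sum_divisors_moebius_dvd 𝕜 N.factorial_ne_zero ((n : ℕ) / d)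
      have h4 (k : ℕ) : (d : ℕ) * k ∣ n ↔ k ∣ (n : ℕ) / d := (Nat.dvd_div_iff_mul_dvd hd).symm
      have h5 : (if Nat.Coprime (n / d) N.factorial then a n else 0) =
          a n * if Nat.Coprime (n / d) N.factorial then 1 else 0 := by split_ifs <;> simp
      simp only [hd, true_and, h4]
      rw [h5, ← h3, Finset.mul_sum]
      refine Finset.sum_congr rfl fun k _ => ?_
      split_ifs <;> ring
    · rw [if_neg (fun h => hd h.1)]
      refine (Finset.sum_eq_zero fun k _ => ?_).symm
      rw [if_neg (fun h => hd ((dvd_mul_right _ _).trans h)), mul_zero]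
  -- Once N ≥ n, the quotient n / d divides N!, so being coprime to N! forces n = d; only the term
  -- at d survives.
  have hlim : Tendsto (fun N : ℕ => ∑' n : ℕ+,
      (if (d : ℕ) ∣ n ∧ Nat.Coprime (n / d) N.factorial then a n else 0)) atTop
      (𝓝 (∑' n : ℕ+, if n = d then a n else 0)) := by
    refine tendsto_tsum_of_dominated_convergence hsum (fun n => ?_)
      (Eventually.of_forall fun N n => by split_ifs <;> simp)
    refine tendsto_const_nhds.congr' ?_
    filter_upwards [eventually_ge_atTop (n : ℕ)] with N hN
    refine if_congr ⟨?_, ?_⟩ rfl rfl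
    · rintro rfl
      simp [Nat.div_self n.pos]
    · rintro ⟨⟨m, hm⟩, hcop⟩
      rw [hm, Nat.mul_div_cancel_left _ d.pos] at hcop
      have hm0 : 0 < m := Nat.pos_of_ne_zero fun h => by simp [h] at hm
      have hmN : m ∣ N.factorial := Nat.dvd_factorial hm0
        ((Nat.le_of_dvd n.pos (Dvd.intro_left _ hm.symm)).trans hN)
      rw [Nat.Coprime, Nat.gcd_eq_left hmN] at hcop
      rw [hcop, mul_one] at hm
      exact PNat.coe_injective hm
  simp only [hsieve, tsum_ite_eq] at hlim
  have had : a d = 0 := (tendsto_nhds_unique hlim tendsto_const_nhds)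
  have hd0 : (((d : ℝ) ^ (-s) : ℝ) : 𝕜) ≠ 0 :=
    RCLike.ofReal_ne_zero.2 (Real.rpow_pos_of_pos (by exact_mod_cast d.pos) _).ne'
  simpa using (mul_eq_zero.1 had).resolve_left hd0

/-- The finitely supported vectors biorthogonal to the vectors `multiplesVec`. -/
noncomputable def divisorsVec (𝕜 : Type*) [RCLike 𝕜] (s : ℝ) (q : ℕ+) :
    lp (fun _ : ℕ+ => 𝕜) 2 :=
  ∑ x ∈ (q : ℕ).divisorsAntidiagonal,
    ((μ x.1 : ℤ) : 𝕜) • lp.single 2 x.2.toPNat' (((x.2 : ℝ) ^ s : ℝ) : 𝕜)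

theorem inner_divisorsVec_multiplesVec (q d : ℕ+) :
    inner 𝕜 (divisorsVec 𝕜 s q) (multiplesVec 𝕜 hs d) = if q = d then 1 else 0 := by
  have h := sum_moebius_mul_dvd_indicator 𝕜 q.ne_zero d
  simp only [PNat.coe_inj] at h
  rw [← h, divisorsVec, sum_inner]
  refine Finset.sum_congr rfl fun x hx => ?_
  have hx0 : 0 < x.2 := Nat.pos_of_ne_zero (Nat.ne_zero_of_mem_divisorsAntidiagonal hx).2
  have hxs : ((x.2 : ℝ) ^ s) * (x.2 : ℝ) ^ (-s) = 1 := by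
    rw [← Real.rpow_add (by exact_mod_cast hx0), add_neg_cancel, Real.rpow_zero]
  rw [inner_smul_left, lp.inner_single_left, map_intCast, multiplesVec_apply]
  -- `hx0` rules out 0, where `toPNat'` takes a default value.
  have hxc : ((x.2.toPNat' : ℕ+) : ℕ) = x.2 := by simp [Nat.toPNat'_coe, hx0]
  rw [hxc]
  split_ifs
  · rw [RCLike.inner_apply, RCLike.conj_ofReal, ← RCLike.ofReal_mul, mul_comm ((x.2 : ℝ) ^ (-s)),
      hxs, RCLike.ofReal_one]
  · simp

theorem inner_multiplesVec_divisorsVec (q d : ℕ+) :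
    inner 𝕜 (multiplesVec 𝕜 hs d) (divisorsVec 𝕜 s q) = if q = d then 1 else 0 := by
  rw [← inner_conj_symm, inner_divisorsVec_multiplesVec]
  split_ifs <;> simp

end MultiplesVector

/-! ### The operator as a series of rank-one operators. -/

section ArithOperator

open InnerProductSpace

variable (𝕜 : Type*) [RCLike 𝕜] {s t : ℝ} (hs : 1 / 2 < s)

/-- The operator `∑ d, J_{-t}(d) w_d ⊗ w_d` on `ℓ²`, where `w_d` is `multiplesVec`. -/
noncomputable def arithOperator (t : ℝ) : lp (fun _ : ℕ+ => 𝕜) 2 →L[𝕜] lp (fun _ : ℕ+ => 𝕜) 2 :=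
  ∑' d : ℕ+, ((negJordan t d : ℝ) : 𝕜) •
    rankOne 𝕜 (multiplesVec 𝕜 hs d) (multiplesVec 𝕜 hs d)

theorem hasSum_arithOperator (ht : 0 < t) :
    HasSum (fun d : ℕ+ => ((negJordan t d : ℝ) : 𝕜) •
      rankOne 𝕜 (multiplesVec 𝕜 hs d) (multiplesVec 𝕜 hs d)) (arithOperator 𝕜 hs t) := by
  refine (Summable.of_norm_bounded ((PNat.summable_rpow_neg_sq hs).mul_right
    (∑' n : ℕ+, ((n : ℝ) ^ (-s)) ^ 2)) fun d => ?_).hasSum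
  rw [← norm_multiplesVec_sq (𝕜 := 𝕜) hs, norm_smul, norm_rankOne, RCLike.norm_ofReal, ← sq]
  exact mul_le_of_le_one_left (sq_nonneg _) (abs_negJordan_le_one ht _)

theorem hasSum_inner_arithOperator (ht : 0 < t) (x y : lp (fun _ : ℕ+ => 𝕜) 2) :
    HasSum (fun d : ℕ+ => ((negJordan t d : ℝ) : 𝕜) *
      (inner 𝕜 x (multiplesVec 𝕜 hs d) * inner 𝕜 (multiplesVec 𝕜 hs d) y))
      (inner 𝕜 x (arithOperator 𝕜 hs t y)) := by
  have h := (hasSum_arithOperator 𝕜 hs ht).mapL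
    ((innerSL 𝕜 x).comp (ContinuousLinearMap.apply 𝕜 _ y))
  refine h.congr_fun fun d => ?_
  simp only [ContinuousLinearMap.comp_apply, ContinuousLinearMap.apply_apply,
    smul_apply, rankOne_apply, innerSL_apply_apply, inner_smul_right]
  ring

theorem isSelfAdjoint_arithOperator (ht : 0 < t) : IsSelfAdjoint (arithOperator 𝕜 hs t) := by
  rw [ContinuousLinearMap.isSelfAdjoint_iff_isSymmetric]
  intro x y
  have h1 := hasSum_inner_arithOperator 𝕜 hs ht x y
  have h2 := (hasSum_inner_arithOperator 𝕜 hs ht y x).map (starRingEnd 𝕜) RCLike.continuous_conj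
  rw [inner_conj_symm] at h2
  refine h2.unique (h1.congr_fun fun d => ?_)
  simp [mul_comm]

/-- Norm limit of the finite-rank partial sums. -/
theorem isCompactOperator_arithOperator (ht : 0 < t) :
    IsCompactOperator (arithOperator 𝕜 hs t) := by
  refine isCompactOperator_of_tendsto (hasSum_arithOperator 𝕜 hs ht)
    (Filter.Eventually.of_forall fun S => ?_)
  change _ ∈ compactOperator _ _ _
  refine Submodule.sum_mem _ fun d _ => Submodule.smul_mem _ _ ?_
  change IsCompactOperator _
  rw [rankOne_def']
  have h : IsCompactOperator (innerSL 𝕜 (multiplesVec 𝕜 hs d)) :=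
    isCompactOperator_of_locallyCompactSpace_dom _
  exact h.clm_comp (ContinuousLinearMap.toSpanSingleton 𝕜 (multiplesVec 𝕜 hs d))

theorem inner_divisorsVec_arithOperator (ht : 0 < t) (q : ℕ+) (x : lp (fun _ : ℕ+ => 𝕜) 2) :
    inner 𝕜 (divisorsVec 𝕜 s q) (arithOperator 𝕜 hs t x) =
      ((negJordan t q : ℝ) : 𝕜) * inner 𝕜 (multiplesVec 𝕜 hs q) x := by
  rw [← (hasSum_inner_arithOperator 𝕜 hs ht _ _).tsum_eq, tsum_eq_single q fun d hd => by
    rw [inner_divisorsVec_multiplesVec, if_neg hd.symm, zero_mul, mul_zero],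
    inner_divisorsVec_multiplesVec, if_pos rfl, one_mul]

theorem ker_arithOperator (ht : 0 < t) : LinearMap.ker
    (arithOperator 𝕜 hs t : lp (fun _ : ℕ+ => 𝕜) 2 →ₗ[𝕜] lp (fun _ : ℕ+ => 𝕜) 2) = ⊥ := by
  refine LinearMap.ker_eq_bot'.2 fun x hx => ?_
  refine eq_zero_of_forall_inner_multiplesVec_eq_zero hs fun q => ?_
  have h := inner_divisorsVec_arithOperator 𝕜 hs ht q x
  rw [show arithOperator 𝕜 hs t x = 0 from hx, inner_zero_right] at h
  exact (mul_eq_zero.1 h.symm).resolve_left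
    (RCLike.ofReal_ne_zero.2 (negJordan_ne_zero ht q.ne_zero))

theorem arithMatrix_eq_gcd {σ τ : ℝ} (n m : ℕ+) : arithMatrix σ τ n m =
    (n : ℝ) ^ (-(τ - σ)) * (m : ℝ) ^ (-(τ - σ)) * ((Nat.gcd n m : ℕ) : ℝ) ^ τ := by
  have hn : (0 : ℝ) < n := by exact_mod_cast n.pos
  have hm : (0 : ℝ) < m := by exact_mod_cast m.pos
  have hg : (0 : ℝ) < (Nat.gcd n m : ℕ) := by exact_mod_cast Nat.gcd_pos_of_pos_left _ n.pos
  have hl : (0 : ℝ) < (Nat.lcm n m : ℕ) := by exact_mod_cast Nat.lcm_pos n.pos m.pos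
  have h : ((Nat.gcd n m : ℕ) : ℝ) ^ τ * ((Nat.lcm n m : ℕ) : ℝ) ^ τ =
      (n : ℝ) ^ τ * (m : ℝ) ^ τ := by
    rw [← Real.mul_rpow hg.le hl.le, ← Real.mul_rpow hn.le hm.le]
    exact_mod_cast congrArg (fun k : ℕ => (k : ℝ) ^ τ) (Nat.gcd_mul_lcm (n : ℕ) m)
  rw [arithMatrix, Matrix.of_apply, div_eq_iff (Real.rpow_pos_of_pos hl _).ne', mul_assoc _ (_ ^ τ),
    h, neg_sub, Real.rpow_sub hn, Real.rpow_sub hm]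
  have := (Real.rpow_pos_of_pos hn τ).ne'
  have := (Real.rpow_pos_of_pos hm τ).ne'
  field_simp

theorem isOperatorOfMatrix_arithOperator {σ τ : ℝ} (hτ : τ < 0) (hστ : 1 / 2 < τ - σ) :
    IsOperatorOfMatrix (arithMatrix σ τ) (arithOperator 𝕜 hστ (-τ)) := by
  have ht : 0 < -τ := neg_pos.2 hτ
  have hentry (n m : ℕ+) : inner 𝕜 (lp.single 2 n (1 : 𝕜) : lp (fun _ : ℕ+ => 𝕜) 2)
      (arithOperator 𝕜 hστ (-τ) (lp.single 2 m (1 : 𝕜))) = ((arithMatrix σ τ n m : ℝ) : 𝕜) := by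
    rw [← (hasSum_inner_arithOperator 𝕜 hστ ht _ _).tsum_eq]
    have hg0 : Nat.gcd (n : ℕ) m ≠ 0 := (Nat.gcd_pos_of_pos_left _ n.pos).ne'
    -- The d-th rank-one term has a nonzero (n, m) entry only when d divides both n and m.
    let g : ℕ → ℝ := fun d => if d ∈ (Nat.gcd (n : ℕ) m).divisors then
      (n : ℝ) ^ (-(τ - σ)) * (m : ℝ) ^ (-(τ - σ)) * negJordan (-τ) d else 0
    have hg : ∑' d : ℕ+, g d = arithMatrix σ τ n m := by
      rw [PNat.coe_injective.tsum_eq (f := g) fun d hd => ?_,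
        tsum_eq_sum (s := (Nat.gcd (n : ℕ) m).divisors) fun d hd => if_neg hd, Finset.sum_congr rfl fun d hd => if_pos hd, ← Finset.mul_sum,
        sum_divisors_negJordan _ hg0, neg_neg, arithMatrix_eq_gcd]
      have : d ∈ (Nat.gcd (n : ℕ) m).divisors := by
        by_contra h
        exact hd (if_neg h)
      exact ⟨⟨d, Nat.pos_of_mem_divisors this⟩, rfl⟩
    rw [← hg, RCLike.ofReal_tsum]
    refine tsum_congr fun d => ?_
    simp only [lp.inner_single_left, lp.inner_single_right, multiplesVec_apply, RCLike.inner_apply,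
      map_one, mul_one, one_mul, g, Nat.mem_divisors, Nat.dvd_gcd_iff, hg0, ne_eq,
      not_false_eq_true, and_true]
    by_cases h1 : (d : ℕ) ∣ n <;> by_cases h2 : (d : ℕ) ∣ m <;> simp [h1, h2]
    ring
  -- Matrix entries determine the action: expand x in the standard basis and use continuity.
  intro x n
  have h := (lp.hasSum_single (by simp) x).mapL
    ((innerSL 𝕜 (lp.single 2 n (1 : 𝕜) : lp (fun _ : ℕ+ => 𝕜) 2)).comp (arithOperator 𝕜 hστ (-τ)))
  simp only [ContinuousLinearMap.comp_apply, innerSL_apply_apply] at h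
  rw [lp.inner_single_left, RCLike.inner_apply, map_one, mul_one] at h
  refine h.congr_fun fun m => ?_
  rw [← hentry, ← mul_one (x m), ← smul_eq_mul (x m), lp.single_smul, map_smul, inner_smul_right,
    smul_eq_mul, mul_one, mul_comm]

end ArithOperator

theorem theorem1p2 (𝕜 : Type*) [RCLike 𝕜] (σ τ : ℝ) (hτ : τ < 0) (hστ : 1 / 2 < τ - σ) :
    ∃ E : lp (fun _ : ℕ+ => 𝕜) 2 →L[𝕜] lp (fun _ : ℕ+ => 𝕜) 2,
      IsOperatorOfMatrix (arithMatrix σ τ) E ∧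
      IsCompactOperator E ∧
      IsSelfAdjoint E ∧
      LinearMap.ker (E : lp (fun _ : ℕ+ => 𝕜) 2 →ₗ[𝕜] lp (fun _ : ℕ+ => 𝕜) 2) = ⊥ ∧
      {r : ℝ | r < 0 ∧ Module.End.HasEigenvalue
        (E : lp (fun _ : ℕ+ => 𝕜) 2 →ₗ[𝕜] lp (fun _ : ℕ+ => 𝕜) 2) (r : 𝕜)}.Infinite ∧
      {r : ℝ | 0 < r ∧ Module.End.HasEigenvalue
        (E : lp (fun _ : ℕ+ => 𝕜) 2 →ₗ[𝕜] lp (fun _ : ℕ+ => 𝕜) 2) (r : 𝕜)}.Infinite := by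
  have ht : 0 < -τ := neg_pos.2 hτ
  have hc := isCompactOperator_arithOperator 𝕜 hστ ht
  have hsa := isSelfAdjoint_arithOperator 𝕜 hστ ht
  have hform (i j : ℕ+) : inner 𝕜 (divisorsVec 𝕜 (τ - σ) i)
      (arithOperator 𝕜 hστ (-τ) (divisorsVec 𝕜 (τ - σ) j)) =
        if i = j then ((negJordan (-τ) i : ℝ) : 𝕜) else 0 := by
    rw [inner_divisorsVec_arithOperator 𝕜 hστ ht, inner_multiplesVec_divisorsVec, mul_ite, mul_one,
      mul_zero]
    simp only [eq_comm]
  obtain ⟨P, hprime, hinj⟩ :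
      ∃ P : ℕ → ℕ+, (∀ i, (P i : ℕ).Prime) ∧ Function.Injective P :=
    ⟨fun i => ⟨Nat.nth Nat.Prime i, (Nat.prime_nth_prime i).pos⟩, Nat.prime_nth_prime,
      fun _ _ h => Nat.nth_injective Nat.infinite_setOfPred_prime (congrArg PNat.val h)⟩
  refine ⟨arithOperator 𝕜 hστ (-τ), isOperatorOfMatrix_arithOperator 𝕜 hτ hστ, hc, hsa,
    ker_arithOperator 𝕜 hστ ht, ?_, ?_⟩
  · refine ContinuousLinearMap.infinite_negative_eigenvalues hc hsa.isSymmetric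
      (v := fun i => divisorsVec 𝕜 (τ - σ) (P i))
      (c := fun i => negJordan (-τ) (P i))
      (fun i => negJordan_prime_neg ht (hprime i)) fun i j => ?_
    rw [hform]
    exact if_congr hinj.eq_iff rfl rfl
  · have hne (i : ℕ) : (P 0 : ℕ) ≠ P (i + 1) :=
      PNat.coe_injective.ne (hinj.ne (Nat.succ_ne_zero i).symm)
    -- Products of the fixed prime `P 0` with the other primes make the form of -E negative
    -- definite.
    have hneg := ContinuousLinearMap.infinite_negative_eigenvalues hc.neg
      (T := -arithOperator 𝕜 hστ (-τ)) hsa.neg.isSymmetric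
      (v := fun i => divisorsVec 𝕜 (τ - σ) (P 0 * P (i + 1)))
      (c := fun i => -negJordan (-τ) (P 0 * P (i + 1)))
      (fun i => neg_lt_zero.2
        (negJordan_prime_mul_prime_pos ht (hprime 0) (hprime (i + 1)) (hne i))) fun i j => ?_
    · refine (hneg.image neg_injective.injOn).mono ?_
      rintro _ ⟨r, ⟨hr, hev⟩, rfl⟩
      refine ⟨neg_pos.2 hr, ?_⟩
      obtain ⟨x, hx⟩ := hev.exists_hasEigenvector
      refine Module.End.hasEigenvalue_of_hasEigenvector (x := x)
        ⟨Module.End.mem_eigenspace_iff.2 ?_, hx.2⟩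
      have h := hx.apply_eq_smul
      change -(arithOperator 𝕜 hστ (-τ) x) = _ at h
      change arithOperator 𝕜 hστ (-τ) x = _
      rw [RCLike.ofReal_neg, neg_smul, ← h, neg_neg]
    · rw [neg_apply, inner_neg_right, hform]
      by_cases hij : i = j
      · subst hij; simp
      · rw [if_neg hij, if_neg, neg_zero]
        intro h
        exact hij (Nat.succ_injective (hinj (mul_left_cancel h)))
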